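/- Let $h,H\in\mathbb C$ and let $f\in L_2(0,\pi)$ be complex-valued. For a complex-valued function $N$ on $(0,\pi)$ put $$N^{*1}=N,\qquad N^{*(\nu+1)}(x)=\int_0^x N(x-t)\,N^{*\nu}(t)\,dt,\quad \nu\ge1,$$ and for $\nu\ge1$ put $$\psi_\nu(x)=\frac{(\pi-x)^\nu}{\nu!},\qquad \Psi_\nu(x,t)=\frac1{\nu!}\Big(H(\pi-x)^\nu+h(\pi-t)^{\nu-1}\big(\pi-t+(x-t)(\nu+H(\pi-t))\big)\Big).$$ Then the nonlinear integral equation $$f(x)=\sum_{\nu=1}^\infty\Big(\psi_\nu(x)N^{*\nu}(x)+\int_0^x\Psi_\nu(x,t)N^{*\nu}(t)\,dt\Big)\quad\text{for almost every }x\in(0,\pi)$$ has a solution $N$ with $(\pi-x)N(x)\in L_2(0,\pi)$, the series converging absolutely for almost every $x\in(0,\pi)$, and any two such solutions coincide almost everywhere on $(0,\pi)$. -/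

import Mathlib

open MeasureTheory Set

noncomputable section

/-- Convolution powers `N^{*ν}` for `ν ≥ 1`: `N^{*1} = N` and
`N^{*(ν+1)}(x) = ∫₀ˣ N(x-t) N^{*ν}(t) dt`.  The value at `ν = 0` is a placeholder that is never
used.  If `N` is square integrable on `(0,T)` for all `T < π`, then all these integrands are
integrable for every `x ∈ (0,π)`. -/
def convPow (N : ℝ → ℂ) : ℕ → ℝ → ℂ
  | 0 => fun _ => 0
  | 1 => N
  | ν + 2 => fun x => ∫ t in (0 : ℝ)..x, N (x - t) * convPow N (ν + 1) t

/-- `ψ_ν(x) = (π - x)^ν / ν!`. -/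
def psiCoeff (ν : ℕ) (x : ℝ) : ℂ :=
  ((Real.pi : ℂ) - x) ^ ν / (Nat.factorial ν : ℂ)

/-- `Ψ_ν(x,t) = (1/ν!) (H (π-x)^ν + h (π-t)^(ν-1) (π - t + (x-t) (ν + H (π-t))))`,
for `ν ≥ 1`. -/
def PsiCoeff (h H : ℂ) (ν : ℕ) (x t : ℝ) : ℂ :=
  (1 / (Nat.factorial ν : ℂ)) *
    (H * ((Real.pi : ℂ) - x) ^ ν +
      h * ((Real.pi : ℂ) - t) ^ (ν - 1) *
        ((Real.pi : ℂ) - t + ((x : ℂ) - t) * ((ν : ℂ) + H * ((Real.pi : ℂ) - t))))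

/-- The `ν`-th term of the series on the right-hand side of the main equation, `ν ≥ 1`. -/
def mainTerm (h H : ℂ) (N : ℝ → ℂ) (ν : ℕ) (x : ℝ) : ℂ :=
  psiCoeff ν x * convPow N ν x + ∫ t in (0 : ℝ)..x, PsiCoeff h H ν x t * convPow N ν t

/-- The main nonlinear integral equation: for almost every `x ∈ (0,π)` the series over `ν ≥ 1`
converges, with sum `f(x)`. -/
def MainEquation (h H : ℂ) (f N : ℝ → ℂ) : Prop :=
  ∀ᵐ x ∂(volume.restrict (Ioo 0 Real.pi)),
    HasSum (fun k : ℕ => mainTerm h H N (k + 1) x) (f x)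

/-- `N` is a solution of the main equation with `(π - x) N(x) ∈ L₂(0,π)`. -/
def IsMainSolution (h H : ℂ) (f N : ℝ → ℂ) : Prop :=
  MemLp (fun x : ℝ => ((Real.pi : ℂ) - x) * N x) 2 (volume.restrict (Ioo 0 Real.pi)) ∧
    MainEquation h H f N

end

open MeasureTheory Set

noncomputable section

/-! Put `w(x) = e^{-lx} (π-x) N(x)`. The exponential is multiplicative under convolution, and on `0
< t < x < π` the factor `π-x` is at most both `π-t` and `π-(x-t)`, so the functions `e^{-lx} (π-x)^ν
N^{*ν}(x)` arise from `w` by Volterra-type bilinear operations with kernels bounded by 1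
(`weightedPow_eq`). Multiplied by `e^{-lx}`, the equation reads `w + R(w) = e^{-lx} f`, with `R` the
sum `remSum`.

By Cauchy–Schwarz these operations send pairs of L₂ functions to bounded functions. In a ball of
small radius `r` the differences of weighted powers grow only linearly in `ν`, and the factorials
make the series converge (`norm_remTerm_sub_le`); the linear part of `R` is small because `e^{-lx}`
has small L₂ norm for large `l`. Hence `R` is 1/2-Lipschitz on the ball, and Banach's theorem gives
a solution there.

Uniqueness is global: the norm of `e^{-lx} g` tends to 0 for each `g` in L₂, so for large `l` any
two given solutions lie in the same ball. -/

/-- Lebesgue measure on `(0, π)`. -/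
abbrev intervalMeasure : Measure ℝ := volume.restrict (Ioo 0 Real.pi)

/-- `g` belongs to `L₂(0, π)` and has norm at most `r`. -/
structure L2Bound (g : ℝ → ℂ) (r : ℝ) : Prop where
  memLp : MemLp g 2 intervalMeasure
  le : eLpNorm g 2 intervalMeasure ≤ ENNReal.ofReal r

lemma L2Bound.mono {g : ℝ → ℂ} {r s : ℝ} (hg : L2Bound g r) (hrs : r ≤ s) : L2Bound g s :=
  ⟨hg.memLp, hg.le.trans (ENNReal.ofReal_le_ofReal hrs)⟩

/-- The factor 2 bounds `√π`, the square root of the interval length. -/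
lemma L2Bound.of_sup {g : ℝ → ℂ} {M : ℝ}
    (hg : AEStronglyMeasurable g intervalMeasure) (hb : ∀ x ∈ Ioo 0 Real.pi, ‖g x‖ ≤ M) :
    L2Bound g (2 * M) := by
  have hae : ∀ᵐ x ∂intervalMeasure, ‖g x‖ ≤ M :=
    (ae_restrict_iff' measurableSet_Ioo).2 (Filter.Eventually.of_forall hb)
  refine ⟨MemLp.of_bound hg M hae, (eLpNorm_le_of_ae_bound hae).trans ?_⟩
  rw [Measure.restrict_apply_univ, Real.volume_Ioo, sub_zero, ENNReal.ofReal_mul zero_le_two]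
  gcongr
  rw [ENNReal.ofReal_rpow_of_pos Real.pi_pos]
  refine ENNReal.ofReal_le_ofReal ?_
  calc Real.pi ^ (ENNReal.toReal 2)⁻¹ ≤ (4 : ℝ) ^ (ENNReal.toReal 2)⁻¹ := by
        gcongr
        exact Real.pi_le_four
    _ = 2 := by
        rw [show (4 : ℝ) = 2 ^ (2 : ℝ) by norm_num, ← Real.rpow_mul zero_le_two]
        norm_num

/-! ### Volterra operations with bounded kernels -/

/-- A measurable kernel bounded by `c` on the triangle `0 < t < x < π`. -/
structure IsBddKernel (k : ℝ → ℝ → ℂ) (c : ℝ) : Prop where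
  meas : Measurable (Function.uncurry k)
  nonneg : 0 ≤ c
  bound : ∀ x t, 0 < t → t < x → x < Real.pi → ‖k x t‖ ≤ c

/-- The Volterra-type bilinear operation `∫₀ˣ k(x,t) a(x-t) b(t) dt`. -/
def volterra (k : ℝ → ℝ → ℂ) (a b : ℝ → ℂ) (x : ℝ) : ℂ :=
  ∫ t in (0 : ℝ)..x, k x t * (a (x - t) * b t)

lemma measurePreserving_reflect (x : ℝ) :
    MeasurePreserving (fun t => x - t) (volume.restrict (Ioo 0 x)) (volume.restrict (Ioo 0 x)) := by
  have h := (Measure.measurePreserving_sub_left (volume : Measure ℝ) x).restrict_preimage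
    (s := Ioo 0 x) measurableSet_Ioo
  have hs : (fun t => x - t) ⁻¹' Ioo 0 x = Ioo 0 x := by
    ext t; simp only [mem_preimage, mem_Ioo]
    constructor <;> rintro ⟨h1, h2⟩ <;> constructor <;> linarith
  rwa [hs] at h

lemma restrict_Ioo_le {x : ℝ} (hx : x ∈ Ioo 0 Real.pi) :
    volume.restrict (Ioo 0 x) ≤ intervalMeasure :=
  Measure.restrict_mono (Ioo_subset_Ioo_right hx.2.le) le_rfl

section Volterra

variable {k : ℝ → ℝ → ℂ} {c r s x : ℝ} {a b : ℝ → ℂ}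

/-- Cauchy–Schwarz, since `t ↦ x - t` preserves the measure on `(0, x)`. -/
lemma eLpNorm_conv_le (ha : L2Bound a r) (hb : L2Bound b s)
    (hx : x ∈ Ioo 0 Real.pi) :
    Integrable (fun t => a (x - t) * b t) (volume.restrict (Ioo 0 x)) ∧
      eLpNorm (fun t => a (x - t) * b t) 1 (volume.restrict (Ioo 0 x)) ≤
        ENNReal.ofReal r * ENNReal.ofReal s := by
  have hle := restrict_Ioo_le hx
  have ha' := ha.memLp.mono_measure hle
  have hb' := hb.memLp.mono_measure hle
  have hmp := measurePreserving_reflect x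
  have hax : MemLp (fun t => a (x - t)) 2 (volume.restrict (Ioo 0 x)) :=
    ha'.comp_measurePreserving hmp
  refine ⟨hax.integrable_mul hb', ?_⟩
  have h1 := eLpNorm_smul_le_mul_eLpNorm (p := 2) (q := 2) (r := 1)
    hb'.aestronglyMeasurable hax.aestronglyMeasurable
  refine (h1.trans (mul_le_mul' ?_ ?_))
  · have : eLpNorm (fun t => a (x - t)) 2 (volume.restrict (Ioo 0 x)) =
        eLpNorm a 2 (volume.restrict (Ioo 0 x)) :=
      eLpNorm_comp_measurePreserving ha'.aestronglyMeasurable hmp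
    rw [this]
    exact (eLpNorm_mono_measure a hle).trans ha.le
  · exact (eLpNorm_mono_measure b hle).trans hb.le

lemma IsBddKernel.ae_bound (hk : IsBddKernel k c) (hx : x ∈ Ioo 0 Real.pi) :
    ∀ᵐ t ∂volume.restrict (Ioo 0 x), ‖k x t‖ ≤ c :=
  (ae_restrict_iff' measurableSet_Ioo).2
    (Filter.Eventually.of_forall fun t ht => hk.bound x t ht.1 ht.2 hx.2)

lemma IsBddKernel.integrable (hk : IsBddKernel k c) (ha : L2Bound a r) (hb : L2Bound b s)
    (hx : x ∈ Ioo 0 Real.pi) :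
    Integrable (fun t => k x t * (a (x - t) * b t)) (volume.restrict (Ioo 0 x)) :=
  (eLpNorm_conv_le ha hb hx).1.bdd_mul
    (hk.meas.comp (measurable_const.prodMk measurable_id)).aestronglyMeasurable (hk.ae_bound hx)

lemma volterra_eq (hx : 0 ≤ x) :
    volterra k a b x = ∫ t in Ioo 0 x, k x t * (a (x - t) * b t) := by
  rw [volterra, intervalIntegral.integral_of_le hx, integral_Ioc_eq_integral_Ioo]

lemma norm_volterra_le (hk : IsBddKernel k c) (ha : L2Bound a r) (hb : L2Bound b s)
    (hr : 0 ≤ r) (hs : 0 ≤ s) (hx : x ∈ Ioo 0 Real.pi) :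
    ‖volterra k a b x‖ ≤ c * (r * s) := by
  obtain ⟨hi, hn⟩ := eLpNorm_conv_le ha hb hx
  rw [volterra_eq hx.1.le]
  calc ‖∫ t in Ioo 0 x, k x t * (a (x - t) * b t)‖
      ≤ ∫ t in Ioo 0 x, c * ‖a (x - t) * b t‖ := by
        refine norm_integral_le_of_norm_le (hi.norm.const_mul c) ?_
        filter_upwards [hk.ae_bound hx] with t ht
        rw [norm_mul]
        gcongr
    _ = c * ∫ t in Ioo 0 x, ‖a (x - t) * b t‖ := integral_const_mul _ _
    _ ≤ c * (r * s) := by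
        refine mul_le_mul_of_nonneg_left ?_ hk.nonneg
        rw [integral_norm_eq_lintegral_enorm hi.1, ← eLpNorm_one_eq_lintegral_enorm]
        refine ENNReal.toReal_le_of_le_ofReal (by positivity) ?_
        rwa [ENNReal.ofReal_mul hr]

lemma volterra_sub_volterra {a' b' : ℝ → ℂ} {r' s' : ℝ} (hk : IsBddKernel k c)
    (ha : L2Bound a r) (hb : L2Bound b s)
    (ha' : L2Bound a' r') (hb' : L2Bound b' s') {r'' s'' : ℝ}
    (hd : L2Bound (fun t => a t - a' t) r'') (hd' : L2Bound (fun t => b t - b' t) s'')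
    (hx : x ∈ Ioo 0 Real.pi) :
    volterra k a b x - volterra k a' b' x =
      volterra k a (fun t => b t - b' t) x + volterra k (fun t => a t - a' t) b' x := by
  simp only [volterra_eq hx.1.le]
  rw [← integral_sub (hk.integrable ha hb hx) (hk.integrable ha' hb' hx),
    ← integral_add (hk.integrable ha hd' hx) (hk.integrable hd hb' hx)]
  congr 1
  ext t
  ring

lemma aestronglyMeasurable_volterra (hk : Measurable (Function.uncurry k))
    (ha : AEStronglyMeasurable a intervalMeasure) (hb : AEStronglyMeasurable b intervalMeasure) :
    AEStronglyMeasurable (volterra k a b) intervalMeasure := by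
  -- Measurable representatives, cut off to the triangle, turn the variable limit into a parameter
  -- integral over the whole line.
  set Q : ℝ × ℝ → ℂ := {p : ℝ × ℝ | 0 < p.2 ∧ p.2 < p.1}.indicator
    (fun p => k p.1 p.2 * (ha.mk a (p.1 - p.2) * hb.mk b p.2)) with hQ
  have hQm : StronglyMeasurable Q := by
    refine StronglyMeasurable.indicator ?_ ?_
    · have h1 := ha.stronglyMeasurable_mk.measurable
      have h2 := hb.stronglyMeasurable_mk.measurable
      exact (hk.mul ((h1.comp (measurable_fst.sub measurable_snd)).mul
        (h2.comp measurable_snd))).stronglyMeasurable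
    · exact (measurableSet_lt measurable_const measurable_snd).inter
        (measurableSet_lt measurable_snd measurable_fst)
  refine (hQm.integral_prod_right' (ν := volume)).aestronglyMeasurable.congr ?_
  refine (ae_restrict_iff' measurableSet_Ioo).2 (Filter.Eventually.of_forall fun x hx => ?_)
  rw [volterra_eq hx.1.le, ← integral_indicator measurableSet_Ioo]
  have hle := restrict_Ioo_le hx
  have h1 : ∀ᵐ t ∂volume.restrict (Ioo 0 x), a (x - t) = ha.mk a (x - t) :=
    (measurePreserving_reflect x).quasiMeasurePreserving.ae
      (ae_mono hle ha.ae_eq_mk)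
  have h2 : ∀ᵐ t ∂volume.restrict (Ioo 0 x), b t = hb.mk b t := ae_mono hle hb.ae_eq_mk
  rw [ae_restrict_iff' measurableSet_Ioo] at h1 h2
  refine integral_congr_ae ?_
  filter_upwards [h1, h2] with t h1 h2
  by_cases ht : t ∈ Ioo 0 x
  · rw [indicator_of_mem ht, h1 ht, h2 ht, hQ,
      indicator_of_mem (show (x, t) ∈ {p : ℝ × ℝ | 0 < p.2 ∧ p.2 < p.1} from ht)]
  · rw [indicator_of_notMem ht, hQ,
      indicator_of_notMem (show (x, t) ∉ {p : ℝ × ℝ | 0 < p.2 ∧ p.2 < p.1} from ht)]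

lemma IsBddKernel.aestronglyMeasurable (hk : IsBddKernel k c) (ha : L2Bound a r)
    (hb : L2Bound b s) : AEStronglyMeasurable (volterra k a b) intervalMeasure :=
  aestronglyMeasurable_volterra hk.meas ha.memLp.1 hb.memLp.1

end Volterra

/-! ### The exponential weight -/

/-- The exponential weight `e^{-lx}`. -/
def expWeight (l x : ℝ) : ℂ := (Real.exp (-(l * x)) : ℝ)

lemma expWeight_ne_zero (l x : ℝ) : expWeight l x ≠ 0 :=
  Complex.ofReal_ne_zero.2 (Real.exp_pos _).ne'

lemma expWeight_sub_mul (l x t : ℝ) : expWeight l (x - t) * expWeight l t = expWeight l x := by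
  rw [expWeight, expWeight, expWeight, ← Complex.ofReal_mul, ← Real.exp_add]
  congr 2
  ring

lemma norm_expWeight (l x : ℝ) : ‖expWeight l x‖ = Real.exp (-(l * x)) := by
  rw [expWeight, Complex.norm_real, Real.norm_eq_abs, abs_of_pos (Real.exp_pos _)]

lemma continuous_expWeight (l : ℝ) : Continuous (expWeight l) := by
  unfold expWeight
  fun_prop

lemma pi_sub_ne_zero {x : ℝ} (hx : x < Real.pi) : (Real.pi : ℂ) - x ≠ 0 := by
  rw [← Complex.ofReal_sub]
  exact Complex.ofReal_ne_zero.2 (sub_pos.2 hx).ne'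

lemma norm_pi_sub {x : ℝ} (hx : x < Real.pi) : ‖(Real.pi : ℂ) - x‖ = Real.pi - x := by
  rw [← Complex.ofReal_sub, Complex.norm_real, Real.norm_eq_abs, abs_of_pos (sub_pos.2 hx)]

/-! ### Weighted convolution powers -/

/-- The kernel of the recursion for weighted convolution powers. -/
def rhoKernel (m : ℕ) (x t : ℝ) : ℂ :=
  ((Real.pi : ℂ) - x) ^ (m + 2) / (((Real.pi : ℂ) - (x - t : ℝ)) * ((Real.pi : ℂ) - t) ^ (m + 1))

lemma isBddKernel_rhoKernel (m : ℕ) : IsBddKernel (rhoKernel m) 1 where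
  meas := by
    unfold rhoKernel Function.uncurry
    fun_prop
  nonneg := zero_le_one
  bound x t h0 h1 h2 := by
    rw [rhoKernel, norm_div, norm_mul, norm_pow, norm_pow, norm_pi_sub h2,
      norm_pi_sub (by linarith : x - t < Real.pi), norm_pi_sub (h1.trans h2)]
    have hx : 0 < Real.pi - x := by linarith
    refine div_le_one_of_le₀ ?_ ?_
    · rw [pow_succ']
      gcongr <;> linarith
    · have h3 : 0 < Real.pi - (x - t) := by linarith
      have h4 : 0 < Real.pi - t := by linarith
      positivity

/-- Weighted convolution powers: if `w(x) = e^{-lx} (π-x) N(x)`, then the `m`-th one is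
`e^{-lx} (π-x)^{m+1} N^{*(m+1)}(x)`. -/
def weightedPow (w : ℝ → ℂ) : ℕ → ℝ → ℂ
  | 0 => w
  | m + 1 => volterra (rhoKernel m) w (weightedPow w m)

lemma weightedPow_eq {l : ℝ} {N w : ℝ → ℂ}
    (hw : ∀ x ∈ Ioo 0 Real.pi, w x = expWeight l x * (((Real.pi : ℂ) - x) * N x)) (m : ℕ) :
    ∀ x ∈ Ioo 0 Real.pi, weightedPow w m x =
      expWeight l x * (((Real.pi : ℂ) - x) ^ (m + 1) * convPow N (m + 1) x) := by
  induction m with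
  | zero => simpa [weightedPow, convPow] using hw
  | succ m ih =>
    intro x hx
    rw [weightedPow, volterra_eq hx.1.le, convPow]
    beta_reduce
    rw [intervalIntegral.integral_of_le hx.1.le,
      integral_Ioc_eq_integral_Ioo, ← mul_assoc, ← integral_const_mul]
    refine setIntegral_congr_fun measurableSet_Ioo fun t ht => ?_
    have h1 : x - t < Real.pi := by linarith [ht.1, hx.2]
    have h2 := pi_sub_ne_zero h1
    have h3 := pi_sub_ne_zero (ht.2.trans hx.2)
    simp only [hw (x - t) ⟨sub_pos.2 ht.2, h1⟩, ih t ⟨ht.1, ht.2.trans hx.2⟩, rhoKernel,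
      ← expWeight_sub_mul l x t]
    field_simp

lemma weightedPow_zero_fun (m : ℕ) : weightedPow 0 m = 0 := by
  cases m with
  | zero => rfl
  | succ m =>
    ext x
    simp [weightedPow, volterra]

/-- Each step gives sup norm at most `r²`, hence L₂ norm at most `2r² ≤ r`. -/
lemma L2Bound.weightedPow {w : ℝ → ℂ} {r : ℝ} (hw : L2Bound w r) (hr : 0 ≤ r) (hr2 : 2 * r ≤ 1)
    (m : ℕ) : L2Bound (weightedPow w m) r := by
  induction m with
  | zero => exact hw
  | succ m ih =>
    have hk := isBddKernel_rhoKernel m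
    refine (L2Bound.of_sup (hk.aestronglyMeasurable hw ih)
      fun x hx => norm_volterra_le hk hw ih hr hr hx).mono ?_
    nlinarith

/-- Splitting the difference of products adds one `δ` per step: sup norm `r(m+2)δ`, hence L₂ norm
`2r(m+2)δ ≤ (m+2)δ`. The pointwise bound keeps the factor `r` that later yields the contraction. -/
lemma weightedPow_sub {w w' : ℝ → ℂ} {r δ : ℝ} (hw : L2Bound w r) (hw' : L2Bound w' r)
    (hd : L2Bound (fun x => w x - w' x) δ) (hr : 0 ≤ r) (hr2 : 2 * r ≤ 1) (hδ : 0 ≤ δ) (m : ℕ) :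
    L2Bound (fun x => weightedPow w m x - weightedPow w' m x) ((m + 1) * δ) ∧
      ∀ x ∈ Ioo 0 Real.pi,
        ‖weightedPow w (m + 1) x - weightedPow w' (m + 1) x‖ ≤ r * ((m + 2) * δ) := by
  have step (m : ℕ) (hm : L2Bound (fun x => weightedPow w m x - weightedPow w' m x) ((m + 1) * δ)) :
      ∀ x ∈ Ioo 0 Real.pi,
        ‖weightedPow w (m + 1) x - weightedPow w' (m + 1) x‖ ≤ r * ((m + 2) * δ) := by
    intro x hx
    have hk := isBddKernel_rhoKernel m
    have hp' := hw'.weightedPow hr hr2 m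
    rw [weightedPow, weightedPow,
      volterra_sub_volterra hk hw (hw.weightedPow hr hr2 m) hw' hp' hd hm hx]
    have h1 := norm_volterra_le hk hw hm hr (by positivity) hx
    have h2 := norm_volterra_le hk hd hp' hδ hr hx
    refine (norm_add_le _ _).trans ((add_le_add h1 h2).trans (le_of_eq ?_))
    ring
  suffices h : L2Bound (fun x => weightedPow w m x - weightedPow w' m x) ((m + 1) * δ) from
    ⟨h, step m h⟩
  induction m with
  | zero => simpa [weightedPow] using hd
  | succ m ih =>
    have hmeas : AEStronglyMeasurable
        (fun x => weightedPow w (m + 1) x - weightedPow w' (m + 1) x) intervalMeasure :=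
      (hw.weightedPow hr hr2 (m + 1)).memLp.1.sub (hw'.weightedPow hr hr2 (m + 1)).memLp.1
    refine (L2Bound.of_sup hmeas (step m ih)).mono ?_
    push_cast
    have : 0 ≤ ((m : ℝ) + 2) * δ := by positivity
    nlinarith

/-! ### Terms of the weighted series -/

/-- The kernel of the integral terms of the main equation, written for weighted powers. -/
def psiKernel (h H : ℂ) (ν : ℕ) (x t : ℝ) : ℂ := PsiCoeff h H ν x t / ((Real.pi : ℂ) - t) ^ ν

/-- A constant controlling all the kernels `psiKernel`. -/
def psiConst (h H : ℂ) : ℝ := ‖H‖ + ‖h‖ * (1 + 4 * ‖H‖)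

lemma psiConst_nonneg (h H : ℂ) : 0 ≤ psiConst h H := by
  unfold psiConst
  positivity

/-- Both `π-x` and `|x-t|` are at most `π-t`, so every summand of `PsiCoeff` is controlled by
`(π-t)^(m+1)`; the 4 in `psiConst` bounds `π`. -/
lemma isBddKernel_psiKernel (h H : ℂ) (m : ℕ) :
    IsBddKernel (psiKernel h H (m + 1)) ((m + 2) / (m + 1).factorial * psiConst h H) where
  meas := by
    unfold psiKernel PsiCoeff Function.uncurry
    fun_prop
  nonneg := mul_nonneg (by positivity) (psiConst_nonneg h H)
  bound x t h0 h1 h2 := by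
    have hx : 0 < Real.pi - x := by linarith
    have ht : 0 < Real.pi - t := by linarith
    have hxt : ‖(x : ℂ) - t‖ ≤ Real.pi - t := by
      rw [← Complex.ofReal_sub, Complex.norm_real, Real.norm_eq_abs, abs_of_pos (by linarith)]
      linarith
    rw [psiKernel, norm_div, norm_pow, norm_pi_sub (h1.trans h2), div_le_iff₀ (by positivity),
      PsiCoeff, norm_mul, norm_div, norm_one, Complex.norm_natCast, Nat.add_sub_cancel,
      div_mul_eq_mul_div, one_mul, div_mul_eq_mul_div, div_mul_eq_mul_div]
    gcongr
    have e1 : ‖H * ((Real.pi : ℂ) - x) ^ (m + 1)‖ ≤ ‖H‖ * (Real.pi - t) ^ (m + 1) := by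
      rw [norm_mul, norm_pow, norm_pi_sub h2]
      gcongr
    have e2 : ‖((m + 1 : ℕ) : ℂ) + H * ((Real.pi : ℂ) - t)‖ ≤ (m + 1) + ‖H‖ * 4 := by
      refine (norm_add_le _ _).trans (add_le_add (by rw [Complex.norm_natCast]; simp) ?_)
      rw [norm_mul, norm_pi_sub (h1.trans h2)]
      gcongr
      linarith [Real.pi_le_four]
    have e3 : ‖(Real.pi : ℂ) - t + ((x : ℂ) - t) * (((m + 1 : ℕ) : ℂ) + H * ((Real.pi : ℂ) - t))‖
        ≤ (Real.pi - t) * ((m + 2) + ‖H‖ * 4) := by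
      refine (norm_add_le _ _).trans ?_
      rw [norm_mul, norm_pi_sub (h1.trans h2)]
      have := mul_le_mul hxt e2 (norm_nonneg _) ht.le
      linarith
    refine (norm_add_le _ _).trans ?_
    rw [norm_mul (h * _), norm_mul h, norm_pow, norm_pi_sub (h1.trans h2)]
    calc _ ≤ ‖H‖ * (Real.pi - t) ^ (m + 1) +
          ‖h‖ * (Real.pi - t) ^ m * ((Real.pi - t) * ((m + 2) + ‖H‖ * 4)) := by gcongr
      _ = (‖H‖ + ‖h‖ * ((m + 2) + ‖H‖ * 4)) * (Real.pi - t) ^ (m + 1) := by ring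
      _ ≤ _ := by
        gcongr
        rw [psiConst]
        have : 0 ≤ (m : ℝ) := by positivity
        nlinarith [norm_nonneg H, mul_nonneg (norm_nonneg h) (norm_nonneg H),
          mul_nonneg this (norm_nonneg H),
          mul_nonneg this (mul_nonneg (norm_nonneg h) (norm_nonneg H))]

/-- The weighted `(m+1)`-st term of the main series, with the leading contribution `w`
removed. -/
def remTerm (h H : ℂ) (l : ℝ) (w : ℝ → ℂ) (m : ℕ) (x : ℝ) : ℂ :=
  (if m = 0 then 0 else weightedPow w m x / ((m + 1).factorial : ℂ)) +
    volterra (psiKernel h H (m + 1)) (expWeight l) (weightedPow w m) x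

lemma expWeight_mul_mainTerm (h H : ℂ) {l : ℝ} {N w : ℝ → ℂ}
    (hw : ∀ x ∈ Ioo 0 Real.pi, w x = expWeight l x * (((Real.pi : ℂ) - x) * N x)) (m : ℕ)
    {x : ℝ} (hx : x ∈ Ioo 0 Real.pi) :
    expWeight l x * mainTerm h H N (m + 1) x =
      (if m = 0 then w x else 0) + remTerm h H l w m x := by
  have h1 : expWeight l x * ∫ t in (0 : ℝ)..x, PsiCoeff h H (m + 1) x t * convPow N (m + 1) t =
      volterra (psiKernel h H (m + 1)) (expWeight l) (weightedPow w m) x := by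
    rw [volterra_eq hx.1.le, intervalIntegral.integral_of_le hx.1.le,
      integral_Ioc_eq_integral_Ioo, ← integral_const_mul]
    refine setIntegral_congr_fun measurableSet_Ioo fun t ht => ?_
    have h3 := pi_sub_ne_zero (ht.2.trans hx.2)
    simp only [weightedPow_eq hw m t ⟨ht.1, ht.2.trans hx.2⟩, psiKernel,
      ← expWeight_sub_mul l x t]
    field_simp
  rw [mainTerm, mul_add, h1, remTerm, ← add_assoc]
  congr 1
  rcases m with _ | m
  · simp [psiCoeff, convPow, hw x hx]
  · rw [weightedPow_eq hw (m + 1) x hx, psiCoeff, if_neg m.succ_ne_zero, if_neg m.succ_ne_zero]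
    ring

lemma remTerm_zero_fun (h H : ℂ) (l : ℝ) (m : ℕ) (x : ℝ) : remTerm h H l 0 m x = 0 := by
  simp [remTerm, weightedPow_zero_fun, volterra]

/-- The majorant of the terms of the main series. -/
def majorant (m : ℕ) : ℝ := 4 * (2 ^ m / m.factorial)

lemma summable_majorant : Summable majorant := (Real.summable_pow_div_factorial 2).mul_left 4

/-- The factor `r` comes from the pointwise bound in `weightedPow_sub` for the first summand, and
from `psiConst h H * q ≤ r` for the integral. -/
lemma norm_remTerm_sub_le (h H : ℂ) {l r δ q : ℝ} {w w' : ℝ → ℂ} (hw : L2Bound w r)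
    (hw' : L2Bound w' r) (hd : L2Bound (fun x => w x - w' x) δ) (hr : 0 ≤ r) (hr2 : 2 * r ≤ 1)
    (hδ : 0 ≤ δ) (hq : L2Bound (expWeight l) q) (hq0 : 0 ≤ q) (hqr : psiConst h H * q ≤ r) (m : ℕ)
    {x : ℝ} (hx : x ∈ Ioo 0 Real.pi) :
    ‖remTerm h H l w m x - remTerm h H l w' m x‖ ≤ r * δ * majorant m := by
  have hk := isBddKernel_psiKernel h H m
  obtain ⟨hm, -⟩ := weightedPow_sub hw hw' hd hr hr2 hδ m
  have hv : volterra (psiKernel h H (m + 1)) (expWeight l) (weightedPow w m) x -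
      volterra (psiKernel h H (m + 1)) (expWeight l) (weightedPow w' m) x =
      volterra (psiKernel h H (m + 1)) (expWeight l)
        (fun t => weightedPow w m t - weightedPow w' m t) x := by
    have hz : L2Bound (fun t => expWeight l t - expWeight l t) 0 := by
      simpa using L2Bound.of_sup (M := 0) aestronglyMeasurable_const
        (fun x _ => (norm_zero (E := ℂ)).le)
    rw [volterra_sub_volterra hk hq (hw.weightedPow hr hr2 m) hq (hw'.weightedPow hr hr2 m)
      hz hm hx, add_eq_left]
    simp [volterra]
  have hf : ((m + 1).factorial : ℝ) = (m + 1) * m.factorial := by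
    rw [Nat.factorial_succ]; push_cast; ring
  have hm0 : (0 : ℝ) < m.factorial := by positivity
  have e1 : ‖(if m = 0 then 0 else weightedPow w m x / ((m + 1).factorial : ℂ)) -
      (if m = 0 then 0 else weightedPow w' m x / ((m + 1).factorial : ℂ))‖ ≤
        r * δ * (1 / m.factorial) := by
    rcases m with _ | m
    · simp only [if_true, sub_zero, norm_zero]
      positivity
    · rw [if_neg m.succ_ne_zero, if_neg m.succ_ne_zero, ← sub_div, norm_div, Complex.norm_natCast,
        div_le_iff₀ (by positivity), hf]
      refine ((weightedPow_sub hw hw' hd hr hr2 hδ m).2 x hx).trans (le_of_eq ?_)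
      field_simp
      push_cast
      ring
  have e2 : ‖volterra (psiKernel h H (m + 1)) (expWeight l)
        (fun t => weightedPow w m t - weightedPow w' m t) x‖ ≤
        r * δ * ((m + 2) / m.factorial) := by
    refine (norm_volterra_le hk hq hm hq0 (by positivity) hx).trans ?_
    calc (m + 2) / (m + 1).factorial * psiConst h H * (q * ((m + 1) * δ))
        = (psiConst h H * q) * (δ * ((m + 2) / m.factorial)) := by
          rw [hf]; field_simp
      _ ≤ r * (δ * ((m + 2) / m.factorial)) := by gcongr
      _ = _ := by ring
  rw [remTerm, remTerm, add_sub_add_comm, hv]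
  refine (norm_add_le _ _).trans ((add_le_add e1 e2).trans ?_)
  rw [← mul_add, ← add_div, majorant, ← mul_div_assoc 4]
  refine mul_le_mul_of_nonneg_left ((div_le_div_iff_of_pos_right hm0).2 ?_) (by positivity)
  -- What remains is `1 + (m + 2) ≤ 4 * 2^m`.
  have h2 : (m : ℝ) ≤ 2 ^ m := by exact_mod_cast Nat.lt_two_pow_self.le
  have h3 : (1 : ℝ) ≤ 2 ^ m := one_le_pow₀ one_le_two
  linarith

/-! ### L₂ bounds and their decay for large exponents -/

lemma L2Bound.zero : L2Bound 0 0 := ⟨MemLp.zero, by simp⟩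

lemma L2Bound.congr {g g' : ℝ → ℂ} {r : ℝ} (hg : L2Bound g r) (h : g =ᵐ[intervalMeasure] g') :
    L2Bound g' r :=
  ⟨(memLp_congr_ae h).1 hg.memLp, (eLpNorm_congr_ae h).symm.le.trans hg.le⟩

lemma L2Bound.add {g g' : ℝ → ℂ} {r s : ℝ} (hg : L2Bound g r) (hg' : L2Bound g' s)
    (hr : 0 ≤ r) (hs : 0 ≤ s) : L2Bound (fun x => g x + g' x) (r + s) := by
  refine ⟨hg.memLp.add hg'.memLp, ?_⟩
  rw [ENNReal.ofReal_add hr hs]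
  exact (eLpNorm_add_le hg.memLp.1 hg'.memLp.1 one_le_two).trans (add_le_add hg.le hg'.le)

lemma L2Bound.neg {g : ℝ → ℂ} {r : ℝ} (hg : L2Bound g r) : L2Bound (fun x => -g x) r :=
  ⟨hg.memLp.neg, (eLpNorm_neg g 2 intervalMeasure).le.trans hg.le⟩

lemma L2Bound.of_memLp {g : ℝ → ℂ} (hg : MemLp g 2 intervalMeasure) :
    L2Bound g (eLpNorm g 2 intervalMeasure).toReal :=
  ⟨hg, (ENNReal.ofReal_toReal hg.2.ne).ge⟩

lemma L2Bound.toReal_le {g : ℝ → ℂ} {r : ℝ} (hg : L2Bound g r) (hr : 0 ≤ r) :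
    (eLpNorm g 2 intervalMeasure).toReal ≤ r :=
  ENNReal.toReal_le_of_le_ofReal hr hg.le

lemma norm_expWeight_le_one {l x : ℝ} (hl : 0 ≤ l) (hx : x ∈ Ioo 0 Real.pi) :
    ‖expWeight l x‖ ≤ 1 := by
  rw [norm_expWeight]
  exact Real.exp_le_one_iff.2 (neg_nonpos.2 (mul_nonneg hl hx.1.le))

lemma memLp_expWeight_mul {l : ℝ} (hl : 0 ≤ l) {g : ℝ → ℂ} (hg : MemLp g 2 intervalMeasure) :
    MemLp (fun x => expWeight l x * g x) 2 intervalMeasure := by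
  refine hg.of_le ((continuous_expWeight l).aestronglyMeasurable.mul hg.1) ?_
  refine (ae_restrict_iff' measurableSet_Ioo).2 (Filter.Eventually.of_forall fun x hx => ?_)
  rw [norm_mul]
  exact mul_le_of_le_one_left (norm_nonneg _) (norm_expWeight_le_one hl hx)

/-- Dominated convergence with majorant `|g|²`. -/
lemma tendsto_eLpNorm_expWeight_mul {g : ℝ → ℂ} (hg : MemLp g 2 intervalMeasure) :
    Filter.Tendsto (fun n : ℕ => eLpNorm (fun x => expWeight n x * g x) 2 intervalMeasure)
      Filter.atTop (nhds 0) := by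
  have h2 : (2 : ENNReal) ≠ 0 := two_ne_zero
  have h2' : (2 : ENNReal) ≠ ⊤ := ENNReal.ofNat_ne_top
  simp only [eLpNorm_eq_lintegral_rpow_enorm_toReal h2 h2']
  have hlim : Filter.Tendsto
      (fun n : ℕ => ∫⁻ x, ‖expWeight n x * g x‖ₑ ^ (ENNReal.toReal 2) ∂intervalMeasure)
      Filter.atTop (nhds (∫⁻ _, 0 ∂intervalMeasure)) := by
    refine tendsto_lintegral_of_dominated_convergence' (fun x => ‖g x‖ₑ ^ (ENNReal.toReal 2))
      (fun n => ((continuous_expWeight n).aestronglyMeasurable.mul hg.1).enorm.pow_const _)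
      (fun n => ?_) (lintegral_rpow_enorm_lt_top_of_eLpNorm_lt_top h2 h2' hg.2).ne ?_
    · refine (ae_restrict_iff' measurableSet_Ioo).2 (Filter.Eventually.of_forall fun x hx => ?_)
      beta_reduce
      gcongr
      rw [enorm_le_iff_norm_le, norm_mul]
      exact mul_le_of_le_one_left (norm_nonneg _) (norm_expWeight_le_one n.cast_nonneg hx)
    · refine (ae_restrict_iff' measurableSet_Ioo).2 (Filter.Eventually.of_forall fun x hx => ?_)
      have h1 : Filter.Tendsto (fun n : ℕ => expWeight n x * g x) Filter.atTop (nhds 0) := by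
        rw [← zero_mul (g x)]
        refine Filter.Tendsto.mul_const _ (tendsto_zero_iff_norm_tendsto_zero.2 ?_)
        simp only [norm_expWeight]
        exact Real.tendsto_exp_neg_atTop_nhds_zero.comp
          (tendsto_natCast_atTop_atTop.atTop_mul_const hx.1)
      have h3 := (ENNReal.continuous_rpow_const (y := ENNReal.toReal 2)).tendsto 0 |>.comp
        (by simpa using h1.enorm)
      simpa [Function.comp_def] using h3
  have h4 := (ENNReal.continuous_rpow_const (y := 1 / ENNReal.toReal 2)).tendsto _ |>.comp hlim
  simpa [Function.comp_def] using h4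

lemma eventually_L2Bound_expWeight_mul {g : ℝ → ℂ} (hg : MemLp g 2 intervalMeasure) {r : ℝ}
    (hr : 0 < r) :
    ∀ᶠ n : ℕ in Filter.atTop, L2Bound (fun x => expWeight n x * g x) r := by
  filter_upwards [(tendsto_eLpNorm_expWeight_mul hg).eventually
    (gt_mem_nhds (ENNReal.ofReal_pos.2 hr))] with n hn
  exact ⟨memLp_expWeight_mul n.cast_nonneg hg, hn.le⟩

/-! ### The contraction argument -/

/-- The radius `r` and the exponent `l` are such that the nonlinear part of the weighted
equation is a contraction on the ball of radius `r`. -/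
structure Admissible (h H : ℂ) (l r : ℝ) : Prop where
  pos : 0 < r
  two_mul_le : 2 * r ≤ 1
  four_mul_le : 4 * (r * ∑' m, majorant m) ≤ 1
  kernel : ∃ q, 0 ≤ q ∧ L2Bound (expWeight l) q ∧ psiConst h H * q ≤ r

lemma exists_eventually_admissible (h H : ℂ) :
    ∃ r : ℝ, 0 < r ∧ ∀ᶠ n : ℕ in Filter.atTop, Admissible h H n r := by
  set B := ∑' m, majorant m with hB
  have hB0 : 0 ≤ B := tsum_nonneg fun m => by unfold majorant; positivity
  have hC := psiConst_nonneg h H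
  -- The radius depends only on the majorant sum, so it is fixed before the exponent grows; `q = r /
  -- (psiConst h H + 1)`.
  refine ⟨1 / (4 * (B + 1)), by positivity, ?_⟩
  have hq : 0 < 1 / (4 * (B + 1)) / (psiConst h H + 1) := by positivity
  have h1 : MemLp (fun _ => (1 : ℂ)) 2 intervalMeasure := memLp_const 1
  filter_upwards [eventually_L2Bound_expWeight_mul h1 hq] with n hn
  refine ⟨by positivity, ?_, ?_, _, hq.le, by simpa using hn, ?_⟩
  · rw [mul_one_div, div_le_one (by positivity)]
    linarith
  · rw [← hB, one_div_mul_eq_div, mul_div_assoc', div_le_one (by positivity)]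
    linarith
  · rw [mul_div_assoc', div_le_iff₀ (by positivity), mul_comm]
    gcongr
    linarith

/-- The sum of the weighted main series without its leading contribution. -/
def remSum (h H : ℂ) (l : ℝ) (w : ℝ → ℂ) (x : ℝ) : ℂ := ∑' m, remTerm h H l w m x

section Contraction

variable {h H : ℂ} {l r : ℝ} {w w' : ℝ → ℂ}

lemma Admissible.summable (A : Admissible h H l r) (hw : L2Bound w r) {x : ℝ}
    (hx : x ∈ Ioo 0 Real.pi) : Summable fun m => remTerm h H l w m x := by
  obtain ⟨q, hq0, hq, hqr⟩ := A.kernel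
  refine Summable.of_norm_bounded (summable_majorant.mul_left (r * r)) fun m => ?_
  -- Comparison with `w' = 0`, where all terms vanish.
  have := norm_remTerm_sub_le h H hw (L2Bound.zero.mono A.pos.le) (δ := r) (by simpa using hw)
    A.pos.le A.two_mul_le A.pos.le hq hq0 hqr m hx
  rwa [remTerm_zero_fun, sub_zero] at this

lemma Admissible.aestronglyMeasurable_remSum (A : Admissible h H l r) (hw : L2Bound w r) :
    AEStronglyMeasurable (remSum h H l w) intervalMeasure := by
  obtain ⟨q, -, hq, -⟩ := A.kernel
  have hterm (m : ℕ) : AEStronglyMeasurable (remTerm h H l w m) intervalMeasure := by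
    have hm := hw.weightedPow A.pos.le A.two_mul_le m
    refine AEStronglyMeasurable.add ?_
      ((isBddKernel_psiKernel h H m).aestronglyMeasurable hq hm)
    split_ifs
    · exact aestronglyMeasurable_const
    · simpa only [div_eq_mul_inv] using hm.memLp.1.mul_const _
  refine aestronglyMeasurable_of_tendsto_ae Filter.atTop
    (f := fun n x => ∑ m ∈ Finset.range n, remTerm h H l w m x)
    (fun n => Finset.aestronglyMeasurable_fun_sum _ fun m _ => hterm m) ?_
  exact (ae_restrict_iff' measurableSet_Ioo).2 (Filter.Eventually.of_forall fun x hx =>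
    (A.summable hw hx).hasSum.tendsto_sum_nat)

lemma Admissible.L2Bound_remSum_sub (A : Admissible h H l r) (hw : L2Bound w r)
    (hw' : L2Bound w' r) {δ : ℝ} (hδ : 0 ≤ δ) (hd : L2Bound (fun x => w x - w' x) δ) :
    L2Bound (fun x => remSum h H l w x - remSum h H l w' x) (δ / 2) := by
  obtain ⟨q, hq0, hq, hqr⟩ := A.kernel
  refine (L2Bound.of_sup (M := r * δ * ∑' m, majorant m) ((A.aestronglyMeasurable_remSum hw).sub
    (A.aestronglyMeasurable_remSum hw')) fun x hx => ?_).mono ?_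
  · change ‖(∑' m, remTerm h H l w m x) - ∑' m, remTerm h H l w' m x‖ ≤ _
    rw [← (A.summable hw hx).tsum_sub (A.summable hw' hx)]
    refine tsum_of_norm_bounded (summable_majorant.hasSum.mul_left (r * δ)) fun m => ?_
    exact norm_remTerm_sub_le h H hw hw' hd A.pos.le A.two_mul_le hδ hq hq0 hqr m hx
  · nlinarith [A.four_mul_le]

lemma remSum_zero_fun (x : ℝ) : remSum h H l 0 x = 0 := by
  simp [remSum, remTerm_zero_fun]

lemma Admissible.L2Bound_remSum (A : Admissible h H l r) (hw : L2Bound w r) :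
    L2Bound (remSum h H l w) (r / 2) := by
  simpa [remSum_zero_fun] using A.L2Bound_remSum_sub hw (L2Bound.zero.mono A.pos.le) A.pos.le
    (by simpa using hw)

/-- The weight never vanishes and the series converges throughout the ball, so only the value of its
sum is at stake. -/
lemma Admissible.hasSum_mainTerm_iff (A : Admissible h H l r) (hw : L2Bound w r) {N : ℝ → ℂ}
    (hwN : ∀ x ∈ Ioo 0 Real.pi, w x = expWeight l x * (((Real.pi : ℂ) - x) * N x)) {x : ℝ}
    (hx : x ∈ Ioo 0 Real.pi) (y : ℂ) :
    HasSum (fun k : ℕ => mainTerm h H N (k + 1) x) y ↔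
      w x + remSum h H l w x = expWeight l x * y := by
  rw [← hasSum_mul_left_iff (expWeight_ne_zero l x)]
  simp only [expWeight_mul_mainTerm h H hwN _ hx]
  have hs : HasSum (fun m => (if m = 0 then w x else 0) + remTerm h H l w m x)
      (w x + remSum h H l w x) :=
    (hasSum_ite_eq 0 (w x)).add (A.summable hw hx).hasSum
  exact ⟨fun h' => hs.unique h', fun h' => h' ▸ hs⟩

lemma Admissible.ae_unique (A : Admissible h H l r) (hw : L2Bound w r) (hw' : L2Bound w' r)
    (heq : ∀ᵐ x ∂intervalMeasure, w x + remSum h H l w x = w' x + remSum h H l w' x) :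
    w =ᵐ[intervalMeasure] w' := by
  have hmem : MemLp (fun x => w x - w' x) 2 intervalMeasure := hw.memLp.sub hw'.memLp
  have hd := L2Bound.of_memLp hmem
  set δ := (eLpNorm (fun x => w x - w' x) 2 intervalMeasure).toReal with hδ
  have hδ0 : 0 ≤ δ := ENNReal.toReal_nonneg
  have h1 : L2Bound (fun x => w x - w' x) (δ / 2) := by
    refine (A.L2Bound_remSum_sub hw hw' hδ0 hd).neg.congr ?_
    filter_upwards [heq] with x hx
    linear_combination -hx
  have h2 : δ = 0 := by linarith [h1.toReal_le (by positivity)]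
  rw [hδ, ENNReal.toReal_eq_zero_iff, or_iff_left hmem.2.ne,
    eLpNorm_eq_zero_iff hmem.1 two_ne_zero] at h2
  filter_upwards [h2] with x hx
  exact sub_eq_zero.1 hx

/-- Fixed point of `u ↦ g - remSum u` on the closed ball of radius `r`, which it preserves since
both summands have norm at most `r / 2`. -/
lemma Admissible.exists_solution (A : Admissible h H l r) {g : ℝ → ℂ} (hg : L2Bound g (r / 2)) :
    ∃ w : ℝ → ℂ, L2Bound w r ∧ ∀ᵐ x ∂intervalMeasure, w x + remSum h H l w x = g x := by
  have hr := A.pos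
  let E := Lp ℂ 2 intervalMeasure
  let s : Set E := Metric.closedBall 0 r
  have hs (u : E) : u ∈ s ↔ L2Bound u r := by
    rw [mem_closedBall_zero_iff, Lp.norm_def]
    exact ⟨fun hu => ⟨Lp.memLp u, (ENNReal.le_ofReal_iff_toReal_le (Lp.eLpNorm_ne_top u) hr.le).2 hu⟩,
      fun hu => hu.toReal_le hr.le⟩
  have hF (u : s) : L2Bound (fun x => g x + -remSum h H l (u : E) x) r :=
    (hg.add (A.L2Bound_remSum ((hs u).1 u.2)).neg (by positivity) (by positivity)).mono (by linarith)
  let F : s → s := fun u => ⟨(hF u).memLp.toLp, (hs _).2 ((hF u).congr (hF u).memLp.coeFn_toLp.symm)⟩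
  have hcontr : ContractingWith (1 / 2) F := by
    refine ⟨by simp [← NNReal.coe_lt_coe]; norm_num, LipschitzWith.of_dist_le_mul fun u v => ?_⟩
    have hd : L2Bound (fun x => (u : E) x - (v : E) x) (dist u v) := by
      rw [Subtype.dist_eq, dist_eq_norm, Lp.norm_def]
      exact (L2Bound.of_memLp (Lp.memLp ((u : E) - (v : E)))).congr (Lp.coeFn_sub _ _)
    have h1 := A.L2Bound_remSum_sub ((hs u).1 u.2) ((hs v).1 v.2) dist_nonneg hd
    have h2 : L2Bound ((F u : E) - (F v : E) : E) (dist u v / 2) := by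
      refine h1.neg.congr ?_
      filter_upwards [Lp.coeFn_sub (F u : E) (F v : E), (hF u).memLp.coeFn_toLp,
        (hF v).memLp.coeFn_toLp] with x h3 h4 h5
      rw [h3, Pi.sub_apply, h4, h5]
      ring
    rw [Subtype.dist_eq, dist_eq_norm, Lp.norm_def]
    refine (h2.toReal_le (by positivity)).trans (le_of_eq ?_)
    push_cast
    ring
  have hcs : CompleteSpace s := Metric.isClosed_closedBall.completeSpace_coe
  have hne : Nonempty s := ⟨⟨0, Metric.mem_closedBall_self hr.le⟩⟩
  obtain ⟨u, hu⟩ : ∃ u, F u = u := ⟨_, hcontr.fixedPoint_isFixedPt⟩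
  refine ⟨(u : E), (hs u).1 u.2, ?_⟩
  have h1 : ((u : E) : ℝ → ℂ) =ᵐ[intervalMeasure] fun x => g x + -remSum h H l (u : E) x := by
    have := (hF u).memLp.coeFn_toLp
    rwa [show (hF u).memLp.toLp = (u : E) from congrArg Subtype.val hu] at this
  filter_upwards [h1] with x hx
  linear_combination hx

end Contraction

lemma IsMainSolution.ae_eq {h H : ℂ} {f N N' : ℝ → ℂ} (hN : IsMainSolution h H f N)
    (hN' : IsMainSolution h H f N') : N' =ᵐ[intervalMeasure] N := by
  obtain ⟨r, hr, hA⟩ := exists_eventually_admissible h H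
  -- One exponent large enough for both solutions puts them in the ball where uniqueness holds.
  obtain ⟨n, A, hw, hw'⟩ := (hA.and ((eventually_L2Bound_expWeight_mul hN.1 hr).and
    (eventually_L2Bound_expWeight_mul hN'.1 hr))).exists
  have heq := A.ae_unique hw' hw (by
    filter_upwards [hN.2, hN'.2, ae_restrict_mem measurableSet_Ioo] with x h1 h2 hx
    rw [(A.hasSum_mainTerm_iff hw (fun _ _ => rfl) hx _).1 h1,
      (A.hasSum_mainTerm_iff hw' (fun _ _ => rfl) hx _).1 h2])
  filter_upwards [heq, ae_restrict_mem measurableSet_Ioo] with x h1 hx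
  exact mul_left_cancel₀ (pi_sub_ne_zero hx.2) (mul_left_cancel₀ (expWeight_ne_zero _ x) h1)

lemma exists_isMainSolution (h H : ℂ) {f : ℝ → ℂ} (hf : MemLp f 2 intervalMeasure) :
    ∃ N : ℝ → ℂ, IsMainSolution h H f N := by
  obtain ⟨r, hr, hA⟩ := exists_eventually_admissible h H
  obtain ⟨n, A, hg⟩ := (hA.and (eventually_L2Bound_expWeight_mul hf (half_pos hr))).exists
  obtain ⟨w, hw, heq⟩ := A.exists_solution hg
  have hwN : ∀ x ∈ Ioo 0 Real.pi, w x = expWeight n x *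
      (((Real.pi : ℂ) - x) * (w x / (expWeight n x * ((Real.pi : ℂ) - x)))) := fun x hx => by
    have h1 := expWeight_ne_zero n x
    have h2 := pi_sub_ne_zero hx.2
    field_simp
  refine ⟨fun x => w x / (expWeight n x * ((Real.pi : ℂ) - x)), ?_, ?_⟩
  -- Here `(π-x) N(x) = e^{nx} w(x)`, and `e^{nx} ≤ e^{nπ}`.
  · have hmeas : AEStronglyMeasurable (fun x => expWeight (-n) x * w x) intervalMeasure :=
      (continuous_expWeight _).aestronglyMeasurable.mul hw.memLp.1
    have hmem : MemLp (fun x => expWeight (-n) x * w x) 2 intervalMeasure := by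
      refine hw.memLp.of_le_mul (c := Real.exp (n * Real.pi)) hmeas ?_
      filter_upwards [ae_restrict_mem measurableSet_Ioo] with x hx
      rw [norm_mul, norm_expWeight, neg_mul, neg_neg]
      gcongr
      exact hx.2.le
    refine (memLp_congr_ae ?_).1 hmem
    filter_upwards [ae_restrict_mem measurableSet_Ioo] with x hx
    have h1 := expWeight_ne_zero n x
    have h2 := pi_sub_ne_zero hx.2
    have h3 : expWeight (-n) x * expWeight n x = 1 := by
      rw [expWeight, expWeight, ← Complex.ofReal_mul, ← Real.exp_add]
      simp
    field_simp
    rw [mul_right_comm, h3, one_mul]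
  · filter_upwards [heq, ae_restrict_mem measurableSet_Ioo] with x h1 hx
    exact (A.hasSum_mainTerm_iff hw hwN hx _).2 h1

end

theorem theorem4 (h H : ℂ) (f : ℝ → ℂ)
    (hf : MemLp f 2 (volume.restrict (Ioo 0 Real.pi))) :
    ∃ N : ℝ → ℂ, IsMainSolution h H f N ∧
      ∀ N' : ℝ → ℂ, IsMainSolution h H f N' →
        N' =ᵐ[volume.restrict (Ioo 0 Real.pi)] N := by
  obtain ⟨N, hN⟩ := exists_isMainSolution h H hf
  exact ⟨N, hN, fun N' hN' => hN.ae_eq hN'⟩
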